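/- Let $d\ge 1$. For $f^0\in C_c^\infty(\mathbb R^d\times\mathbb R^d)$ let $f$ denote the (unique, classical) solution of the kinetic transport equation $$\partial_t f(t,x,v)+v\cdot\nabla_x f(t,x,v)=0,\qquad f(0,x,v)=f^0(x,v),\qquad (t,x,v)\in\mathbb R\times\mathbb R^d\times\mathbb R^d .$$ Then the endpoint Strichartz estimate fails: there is no finite constant $C$ such that $$\|f\|_{L^2_tL^{\frac{2d}{d-1}}_xL^{\frac{2d}{d+1}}_v}\le C\,\|f^0\|_{L^2_{x,v}}$$ for all real-valued $f^0\in C_c^\infty(\mathbb R^d\times\mathbb R^d)$; a fortiori there is no such constant for all $f^0\in L^2(\mathbb R^d\times\mathbb R^d)$. Here $$\|f\|_{L^q_tL^p_xL^r_v}=\Big\|\,t\mapsto\big\|\,x\mapsto\|f(t,x,\cdot)\|_{L^r(\mathbb R^d)}\big\|_{L^p(\mathbb R^d)}\Big\|_{L^q(\mathbb R)}\in[0,\infty],$$ all with respect to Lebesgue measure, and $\frac{2d}{d-1}=\infty$ when $d=1$. -/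

import Mathlib

open MeasureTheory
open scoped ENNReal NNReal ContDiff

/-- `f` is a classical solution of the kinetic transport equation
`∂ₜ f(t,x,v) + v · ∇ₓ f(t,x,v) = 0` for all `(t,x,v) ∈ ℝ × ℝᵈ × ℝᵈ`, with `f(0,x,v) = f₀(x,v)`. -/
structure IsKineticTransportSolution {d : ℕ}
    (f : ℝ → EuclideanSpace ℝ (Fin d) → EuclideanSpace ℝ (Fin d) → ℝ)
    (f₀ : EuclideanSpace ℝ (Fin d) × EuclideanSpace ℝ (Fin d) → ℝ) : Prop where
  contDiff : ContDiff ℝ 1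
    (fun z : ℝ × EuclideanSpace ℝ (Fin d) × EuclideanSpace ℝ (Fin d) => f z.1 z.2.1 z.2.2)
  equation : ∀ (t : ℝ) (x v : EuclideanSpace ℝ (Fin d)),
    deriv (fun s => f s x v) t + inner ℝ v (gradient (fun y => f t y v) x) = 0
  initial : ∀ x v : EuclideanSpace ℝ (Fin d), f 0 x v = f₀ (x, v)

/-- The mixed norm `‖f‖_{L^q_t L^p_x L^r_v}` with respect to Lebesgue measure in each variable:
the `L^r` norm in `v` is taken first, then the `L^p` norm in `x`, then the `L^q` norm in `t`.
It takes values in `[0,∞]`. -/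
noncomputable def mixedNorm {d : ℕ} (q p r : ℝ≥0∞)
    (f : ℝ → EuclideanSpace ℝ (Fin d) → EuclideanSpace ℝ (Fin d) → ℝ) : ℝ≥0∞ :=
  eLpNorm (fun t => eLpNorm (fun x => eLpNorm (fun v => f t x v) r volume) p volume) q volume

/-- The endpoint Strichartz estimate in dimension `d`: for some finite constant `C`,
`‖f‖_{L²_t L^{2d/(d-1)}_x L^{2d/(d+1)}_v} ≤ C ‖f₀‖_{L²_{x,v}}`
for all smooth compactly supported data `f₀`, where `f` is the solution with data `f₀`.
The exponents are computed in `[0,∞]`, so that `2d/(d-1) = ∞` for `d = 1`. -/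
def EndpointStrichartzEstimate (d : ℕ) : Prop :=
  ∃ C : ℝ≥0, ∀ f₀ : EuclideanSpace ℝ (Fin d) × EuclideanSpace ℝ (Fin d) → ℝ,
    ContDiff ℝ ∞ f₀ → HasCompactSupport f₀ →
    ∀ f : ℝ → EuclideanSpace ℝ (Fin d) → EuclideanSpace ℝ (Fin d) → ℝ,
      IsKineticTransportSolution f f₀ →
      mixedNorm 2 (2 * (d : ℝ≥0∞) / ((d : ℝ≥0∞) - 1)) (2 * (d : ℝ≥0∞) / ((d : ℝ≥0∞) + 1)) f
        ≤ (C : ℝ≥0∞) * eLpNorm f₀ 2 volume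

open Set Metric

variable {d : ℕ}

/-! The counterexample sends particles of every speed below `R` through one ball. Let `w =
speedWeight`, and let the datum be `w(v)`, smoothly cut off to the points whose trajectory meets the
unit ball during `[0,1]`. Then `f(t,x,v) = w(v)` for `t ∈ [0,1]`, `|x| < 1`, `|v| < R`, so the left
side is at least a constant times `(∫_{|v|<R} w^r)^{1/r}` with `r = 2d/(d+1)` (`le_mixedNorm`). For
fixed `v` the datum lives on a tube in `x` of volume `O(1+|v|)`, so its squared `L²` norm is
`O(∫_{|v|<2R} w²(1+|v|))` (`eLpNorm_two_le`). The choice of `w` makes both integrands comparable to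
`(1+|v|²)^{-d/2}`, with integral `J(R)`. The estimate would give `J^{1/2+1/(2d)} ≲ J^{1/2}`, so `J`
would be bounded, yet it diverges (`iSup_speedIntegral`). -/

/-- The free transport of `f₀` along straight lines. -/
def freeTransport (f₀ : EuclideanSpace ℝ (Fin d) × EuclideanSpace ℝ (Fin d) → ℝ) :
    ℝ → EuclideanSpace ℝ (Fin d) → EuclideanSpace ℝ (Fin d) → ℝ :=
  fun t x v => f₀ (x - t • v, v)

theorem isKineticTransportSolution_freeTransport
    {f₀ : EuclideanSpace ℝ (Fin d) × EuclideanSpace ℝ (Fin d) → ℝ} (hf : ContDiff ℝ 1 f₀) :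
    IsKineticTransportSolution (freeTransport f₀) f₀ where
  contDiff := by
    unfold freeTransport
    fun_prop
  equation t x v := by
    have hd : DifferentiableAt ℝ f₀ (x - t • v, v) := (hf.differentiable one_ne_zero) _
    have h1 : HasDerivAt (fun s : ℝ => (x - s • v, v)) (-v, (0 : EuclideanSpace ℝ (Fin d))) t := by
      have := ((hasDerivAt_id t).smul_const v).const_sub x
      simp only [id, one_smul] at this
      exact this.prodMk (hasDerivAt_const t v)
    have h2 : HasFDerivAt (fun y : EuclideanSpace ℝ (Fin d) => (y - t • v, v))
        ((ContinuousLinearMap.id ℝ _).prod 0) x :=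
      ((hasFDerivAt_id x).sub_const (t • v)).prodMk (hasFDerivAt_const v x)
    have e1 := (hd.hasFDerivAt.comp_hasDerivAt t h1).deriv
    have e2 := (hd.hasFDerivAt.comp x h2).fderiv
    have e3 : fderiv ℝ f₀ (x - t • v, v) (-v, 0) = - fderiv ℝ f₀ (x - t • v, v) (v, 0) := by
      rw [← map_neg, Prod.neg_mk, neg_zero]
    simp only [Function.comp_def] at e1 e2
    rw [real_inner_comm, inner_gradient_left]
    simp only [freeTransport]
    rw [e1, e2, e3]
    simp
  initial x v := by simp [freeTransport]

/-! ### Incoming particles and the smooth cutoff -/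

/-- The phase space points of speed less than `R` whose free trajectory
meets the ball of radius `a` during the unit time interval. -/
def incomingSet (d : ℕ) (a R : ℝ) : Set (EuclideanSpace ℝ (Fin d) × EuclideanSpace ℝ (Fin d)) :=
  {z | ‖z.2‖ < R ∧ ∃ t ∈ Icc (0 : ℝ) 1, ‖z.1 + t • z.2‖ < a}

theorem isOpen_incomingSet (a R : ℝ) : IsOpen (incomingSet d a R) := by
  have : incomingSet d a R = {z | ‖z.2‖ < R} ∩ ⋃ t ∈ Icc (0 : ℝ) 1, {z | ‖z.1 + t • z.2‖ < a} := by
    ext z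
    simp [incomingSet]
  rw [this]
  refine (isOpen_lt (by fun_prop) (by fun_prop)).inter (isOpen_biUnion fun t _ => ?_)
  exact isOpen_lt (by fun_prop) (by fun_prop)

theorem incomingSet_subset_closedBall (a R : ℝ) :
    incomingSet d a R ⊆ closedBall 0 (|a| + |R|) := by
  rintro ⟨x, v⟩ ⟨hv, t, ht, hx⟩
  simp only at hv hx
  have h1 : ‖x‖ ≤ ‖x + t • v‖ + ‖t • v‖ := by
    simpa using norm_sub_le (x + t • v) (t • v)
  have h2 : ‖t • v‖ ≤ ‖v‖ := by
    rw [norm_smul, Real.norm_eq_abs, abs_of_nonneg ht.1]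
    exact mul_le_of_le_one_left (norm_nonneg v) ht.2
  have := le_abs_self a
  have := le_abs_self R
  have := abs_nonneg a
  simp only [mem_closedBall, dist_zero_right, Prod.norm_def, max_le_iff]
  constructor <;> linarith

/-- The set is the image of a compact set of triples `(t, y, v)` under `(y - t v, v)`. -/
theorem isClosed_incoming (a R : ℝ) :
    IsClosed {z : EuclideanSpace ℝ (Fin d) × EuclideanSpace ℝ (Fin d) |
      ‖z.2‖ ≤ R ∧ ∃ t ∈ Icc (0 : ℝ) 1, ‖z.1 + t • z.2‖ ≤ a} := by
  have hK : IsCompact (Icc (0 : ℝ) 1 ×ˢ closedBall (0 : EuclideanSpace ℝ (Fin d)) a ×ˢ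
      closedBall (0 : EuclideanSpace ℝ (Fin d)) R) :=
    isCompact_Icc.prod ((isCompact_closedBall _ _).prod (isCompact_closedBall _ _))
  have hc : Continuous fun w : ℝ × EuclideanSpace ℝ (Fin d) × EuclideanSpace ℝ (Fin d) =>
      (w.2.1 - w.1 • w.2.2, w.2.2) := by fun_prop
  convert (hK.image hc).isClosed using 1
  ext ⟨x, v⟩
  simp only [mem_ofPred_eq, mem_image, mem_prod, mem_closedBall, dist_zero_right, Prod.exists,
    Prod.mk.injEq]
  constructor
  · rintro ⟨hv, t, ht, hx⟩
    exact ⟨t, x + t • v, v, ⟨ht, hx, hv⟩, by simp, rfl⟩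
  · rintro ⟨t, y, w, ⟨ht, hy, hw⟩, rfl, rfl⟩
    exact ⟨hw, t, ht, by simpa using hy⟩

theorem volume_incoming_section_le (v : EuclideanSpace ℝ (Fin d)) :
    volume {x : EuclideanSpace ℝ (Fin d) | ∃ t ∈ Icc (0 : ℝ) 1, ‖x + t • v‖ < 2} ≤
      ENNReal.ofReal (‖v‖ + 3) * volume (ball (0 : EuclideanSpace ℝ (Fin d)) 3) := by
  -- Times are rounded down to multiples of `1/N`. Since `‖v‖ ≤ N`, this moves a point by at most 1,
  -- so radius 2 grows to 3.
  set N : ℕ := ⌈‖v‖⌉₊ + 1 with hN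
  have hNpos : (0 : ℝ) < N := by positivity
  have hvN : ‖v‖ ≤ N := by
    rw [hN]
    push_cast
    linarith [Nat.le_ceil ‖v‖]
  have hsub : {x : EuclideanSpace ℝ (Fin d) | ∃ t ∈ Icc (0 : ℝ) 1, ‖x + t • v‖ < 2} ⊆
      ⋃ i ∈ Finset.range (N + 1), ball (-((i / N : ℝ) • v)) 3 := by
    rintro x ⟨t, ht, hx⟩
    have htN : 0 ≤ t * N := mul_nonneg ht.1 hNpos.le
    have h1 := Nat.floor_le htN
    have h2 := Nat.lt_floor_add_one (t * N)
    refine mem_biUnion (x := ⌊t * N⌋₊) ?_ ?_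
    · simp only [Finset.coe_range, mem_Iio]
      refine Nat.lt_succ_of_le (Nat.floor_le_of_le ?_)
      exact mul_le_of_le_one_left hNpos.le ht.2
    · rw [mem_ball, dist_eq_norm, sub_neg_eq_add]
      have h3 : |(⌊t * N⌋₊ / N : ℝ) - t| ≤ 1 / N := by
        rw [abs_le, neg_le_sub_iff_le_add, sub_le_iff_le_add, ← sub_le_iff_le_add',
          le_div_iff₀ hNpos, div_le_iff₀ hNpos, sub_mul, add_mul, div_mul_cancel₀ _ hNpos.ne',
          div_mul_cancel₀ _ hNpos.ne']
        constructor <;> linarith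
      have h4 : x + (⌊t * N⌋₊ / N : ℝ) • v = (x + t • v) + ((⌊t * N⌋₊ / N : ℝ) - t) • v := by
        module
      have h5 : ‖((⌊t * N⌋₊ / N : ℝ) - t) • v‖ ≤ 1 := by
        rw [norm_smul, Real.norm_eq_abs]
        calc _ ≤ 1 / N * (N : ℝ) := by gcongr
          _ = 1 := by field_simp
      rw [h4]
      linarith [norm_add_le (x + t • v) (((⌊t * N⌋₊ / N : ℝ) - t) • v)]
  calc _ ≤ volume (⋃ i ∈ Finset.range (N + 1), ball (-((i / N : ℝ) • v)) 3) := measure_mono hsub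
    _ ≤ ∑ i ∈ Finset.range (N + 1), volume (ball (-((i / N : ℝ) • v)) 3) :=
      measure_biUnion_finset_le _ _
    _ = (N + 1 : ℕ) * volume (ball (0 : EuclideanSpace ℝ (Fin d)) 3) := by
      simp [Measure.addHaar_ball_center]
    _ ≤ _ := by
      gcongr
      rw [← ENNReal.ofReal_natCast]
      refine ENNReal.ofReal_le_ofReal ?_
      rw [hN]
      push_cast
      linarith [Nat.ceil_lt_add_one (norm_nonneg v)]

theorem exists_cutoff (R : ℝ) :
    ∃ χ : EuclideanSpace ℝ (Fin d) × EuclideanSpace ℝ (Fin d) → ℝ, ContDiff ℝ ∞ χ ∧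
      (∀ z, χ z ∈ Icc (0 : ℝ) 1) ∧ (∀ z ∉ incomingSet d 2 (2 * R), χ z = 0) ∧
      ∀ z ∈ incomingSet d 1 R, χ z = 1 := by
  -- For `R = 0` the closed set contains points with `v = 0` but the open one is empty, so the
  -- separation below needs `R > 0`.
  rcases le_or_gt R 0 with hR | hR
  · refine ⟨0, contDiff_const, by simp, by simp, fun z hz => ?_⟩
    exact absurd (hz.1.trans_le hR) (norm_nonneg _).not_gt
  obtain ⟨χ, h1, h2, h3, h4⟩ := exists_contMDiff_support_eq_eq_one_iff (n := ⊤)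
    (modelWithCornersSelf ℝ (EuclideanSpace ℝ (Fin d) × EuclideanSpace ℝ (Fin d)))
    (isOpen_incomingSet (d := d) 2 (2 * R)) (isClosed_incoming (d := d) 1 R) (by
      rintro z ⟨hv, t, ht, hx⟩
      exact ⟨by linarith, t, ht, by linarith⟩)
  refine ⟨χ, h1.contDiff, fun z => h2 (mem_range_self z), fun z hz => ?_, fun z hz => ?_⟩
  · rw [← h3] at hz
    exact Function.notMem_support.1 hz
  · obtain ⟨hv, t, ht, hx⟩ := hz
    exact (h4 z).1 ⟨hv.le, t, ht, hx.le⟩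

/-! ### The velocity integral: doubling and divergence -/

/-- The velocity integral, diverging logarithmically as `R → ⊤`,
that governs both sides of the estimate. -/
noncomputable def speedIntegral (d : ℕ) (R : ℝ) : ℝ≥0∞ :=
  ∫⁻ v in ball (0 : EuclideanSpace ℝ (Fin d)) R, ENNReal.ofReal ((1 + ‖v‖ ^ 2) ^ (-(d : ℝ) / 2))

theorem speedIntegral_lt_top (R : ℝ) : speedIntegral d R < ⊤ := by
  calc speedIntegral d R ≤ ∫⁻ v in ball (0 : EuclideanSpace ℝ (Fin d)) R, 1 := by
        refine lintegral_mono fun v => ?_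
        rw [ENNReal.ofReal_le_one]
        refine Real.rpow_le_one_of_one_le_of_nonpos (by nlinarith [sq_nonneg ‖v‖]) ?_
        have : (0 : ℝ) ≤ d := by positivity
        linarith
    _ < ⊤ := by simpa using measure_ball_lt_top

theorem speedIntegral_pos {R : ℝ} (hR : 0 < R) : 0 < speedIntegral d R := by
  refine (setLIntegral_pos_iff (by fun_prop)).2 ?_
  have : Function.support (fun v : EuclideanSpace ℝ (Fin d) =>
      ENNReal.ofReal ((1 + ‖v‖ ^ 2) ^ (-(d : ℝ) / 2))) = univ := by
    ext v
    have : 0 < (1 + ‖v‖ ^ 2) ^ (-(d : ℝ) / 2) := by positivity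
    simpa using this
  rw [this, univ_inter]
  exact measure_ball_pos _ _ hR

/-- Substitute `v = 2u`: the Jacobian is `2 ^ d` and the integrand is radially decreasing. -/
theorem speedIntegral_two_mul_le (R : ℝ) :
    speedIntegral d (2 * R) ≤ 2 ^ d * speedIntegral d R := by
  let E := EuclideanSpace ℝ (Fin d)
  let g : E → ℝ≥0∞ := fun v => ENNReal.ofReal ((1 + ‖v‖ ^ 2) ^ (-(d : ℝ) / 2))
  have hg : Measurable g := by fun_prop
  have key : ENNReal.ofReal |((2 : ℝ) ^ d)⁻¹| * speedIntegral d (2 * R) ≤ speedIntegral d R := by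
    have h1 := Measure.map_addHaar_smul (volume : Measure E) (two_ne_zero (α := ℝ))
    rw [finrank_euclideanSpace_fin] at h1
    calc _ = ∫⁻ v, (ball (0 : E) (2 * R)).indicator g v
          ∂(ENNReal.ofReal |((2 : ℝ) ^ d)⁻¹| • (volume : Measure E)) := by
          rw [lintegral_smul_measure, lintegral_indicator measurableSet_ball]
          rfl
      _ = ∫⁻ u : E, (ball (0 : E) (2 * R)).indicator g ((2 : ℝ) • u) := by
          rw [← h1, lintegral_map (hg.indicator measurableSet_ball) (measurable_const_smul _)]
      _ ≤ ∫⁻ u : E, (ball (0 : E) R).indicator g u := by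
          refine lintegral_mono fun u => ?_
          by_cases hu : u ∈ ball (0 : E) R
          · rw [indicator_of_mem hu]
            refine (indicator_le_self _ _ _).trans (ENNReal.ofReal_le_ofReal ?_)
            refine Real.rpow_le_rpow_of_nonpos (by positivity) ?_ ?_
            · rw [norm_smul]
              norm_num
              nlinarith [norm_nonneg u]
            · have : (0 : ℝ) ≤ d := by positivity
              linarith
          · rw [indicator_of_notMem]
            · exact zero_le
            · simpa [norm_smul] using hu
      _ = _ := by
          rw [lintegral_indicator measurableSet_ball]
          rfl
  have h2 : ENNReal.ofReal |((2 : ℝ) ^ d)⁻¹| = ((2 : ℝ≥0∞) ^ d)⁻¹ := by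
    rw [abs_of_nonneg (by positivity), ENNReal.ofReal_inv_of_pos (by positivity),
      ENNReal.ofReal_pow (by norm_num)]
    simp
  rw [h2] at key
  rwa [mul_comm, ← div_eq_mul_inv, ENNReal.div_le_iff_le_mul (by simp) (by simp),
    mul_comm (speedIntegral d R)] at key

theorem not_integrable_speed (hd : 1 ≤ d) :
    ¬ Integrable (fun v : EuclideanSpace ℝ (Fin d) => (1 + ‖v‖ ^ 2) ^ (-(d : ℝ) / 2)) := by
  have : Nontrivial (EuclideanSpace ℝ (Fin d)) :=
    Module.nontrivial_of_finrank_pos (R := ℝ) (by rwa [finrank_euclideanSpace_fin])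
  rw [integrable_fun_norm_addHaar volume (f := fun y : ℝ => (1 + y ^ 2) ^ (-(d : ℝ) / 2)),
    finrank_euclideanSpace_fin]
  intro h
  -- In polar coordinates, `1 + y² ≤ 2y²` for `y > 1` bounds the radial density below by a multiple
  -- of `1/y`.
  have h1 : IntegrableOn (fun y : ℝ => y⁻¹ * 2 ^ (-(d : ℝ) / 2)) (Ioi 1) := by
    refine (h.mono_set (Ioi_subset_Ioi zero_le_one)).mono' (by fun_prop) ?_
    refine (ae_restrict_mem measurableSet_Ioi).mono fun y (hy : 1 < y) => ?_
    have hy0 : 0 < y := by linarith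
    have hd0 : (0 : ℝ) ≤ d := by positivity
    rw [Real.norm_of_nonneg (by positivity), smul_eq_mul]
    calc y⁻¹ * 2 ^ (-(d : ℝ) / 2) = y ^ (d - 1) * ((2 * y ^ 2) ^ (-(d : ℝ) / 2)) := by
          rw [Real.mul_rpow (by norm_num) (by positivity), ← Real.rpow_natCast y 2,
            ← Real.rpow_mul hy0.le, ← Real.rpow_natCast y (d - 1), mul_left_comm,
            ← Real.rpow_add hy0, ← Real.rpow_neg_one, mul_comm, Nat.cast_sub hd]
          congr 2
          push_cast
          ring
      _ ≤ _ := by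
          refine mul_le_mul_of_nonneg_left ?_ (by positivity)
          exact Real.rpow_le_rpow_of_nonpos (by positivity) (by nlinarith) (by linarith)
  refine not_integrableOn_Ioi_inv (a := 1) ?_
  have h2 : (2 : ℝ) ^ (-(d : ℝ) / 2) ≠ 0 := by positivity
  refine (h1.mul_const (2 ^ (-(d : ℝ) / 2) : ℝ)⁻¹).congr (Filter.Eventually.of_forall fun y => ?_)
  field_simp

theorem iSup_speedIntegral (hd : 1 ≤ d) : ⨆ n : ℕ, speedIntegral d (n + 1) = ⊤ := by
  have hmeas : Measurable fun v : EuclideanSpace ℝ (Fin d) =>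
    (1 + ‖v‖ ^ 2) ^ (-(d : ℝ) / 2) := by fun_prop
  have hmono : Monotone fun n : ℕ => ball (0 : EuclideanSpace ℝ (Fin d)) ((n : ℝ) + 1) :=
    fun m n hmn => ball_subset_ball (by gcongr)
  unfold speedIntegral
  rw [← setLIntegral_iUnion_of_directed _ (directed_of_isDirected_le hmono)]
  have hU : ⋃ n : ℕ, ball (0 : EuclideanSpace ℝ (Fin d)) ((n : ℝ) + 1) = univ := by
    refine eq_univ_of_forall fun v => mem_iUnion.2 ?_
    obtain ⟨n, hn⟩ := exists_nat_gt ‖v‖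
    exact ⟨n, by simpa using hn.trans (lt_add_one _)⟩
  rw [hU, setLIntegral_univ]
  by_contra hne
  refine not_integrable_speed hd ⟨hmeas.aestronglyMeasurable, ?_⟩
  rw [hasFiniteIntegral_iff_ofReal (Filter.Eventually.of_forall fun v => by positivity)]
  exact lt_top_iff_ne_top.2 hne

/-! ### The weight and the two sides of the estimate -/

/-- The weight in the velocity variable of the counterexample. -/
noncomputable def speedWeight (v : EuclideanSpace ℝ (Fin d)) : ℝ :=
  (1 + ‖v‖ ^ 2) ^ (-((d : ℝ) + 1) / 4)

theorem speedWeight_pos (v : EuclideanSpace ℝ (Fin d)) : 0 < speedWeight v := by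
  unfold speedWeight
  positivity

theorem contDiff_speedWeight : ContDiff ℝ ∞ (speedWeight (d := d)) := by
  refine ContDiff.rpow_const_of_ne (contDiff_const.add (contDiff_norm_sq ℝ)) fun v => ?_
  positivity

theorem speedWeight_rpow (v : EuclideanSpace ℝ (Fin d)) :
    speedWeight v ^ (2 * (d : ℝ) / (d + 1)) = (1 + ‖v‖ ^ 2) ^ (-(d : ℝ) / 2) := by
  unfold speedWeight
  rw [← Real.rpow_mul (by positivity)]
  congr 1
  field_simp
  ring

/-- The tube factor `‖v‖ + 3` costs half a power of `1 + ‖v‖²`, which turns the exponent `-(d+1)/2`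
of the squared weight into `-d/2`. -/
theorem speedWeight_sq_mul_le (v : EuclideanSpace ℝ (Fin d)) :
    speedWeight v ^ 2 * (‖v‖ + 3) ≤ 4 * (1 + ‖v‖ ^ 2) ^ (-(d : ℝ) / 2) := by
  have hp : 0 < 1 + ‖v‖ ^ 2 := by positivity
  have h1 : ‖v‖ + 3 ≤ 4 * (1 + ‖v‖ ^ 2) ^ (1 / 2 : ℝ) := by
    rw [← Real.sqrt_eq_rpow]
    have := Real.one_le_sqrt.2 (show 1 ≤ 1 + ‖v‖ ^ 2 by nlinarith [sq_nonneg ‖v‖])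
    have := Real.le_sqrt_of_sq_le (show ‖v‖ ^ 2 ≤ 1 + ‖v‖ ^ 2 by linarith)
    linarith
  calc _ ≤ speedWeight v ^ 2 * (4 * (1 + ‖v‖ ^ 2) ^ (1 / 2 : ℝ)) := by gcongr
    _ = 4 * (speedWeight v ^ 2 * (1 + ‖v‖ ^ 2) ^ (1 / 2 : ℝ)) := by ring
    _ = _ := by
      unfold speedWeight
      rw [← Real.rpow_natCast, ← Real.rpow_mul hp.le, ← Real.rpow_add hp]
      congr 2
      push_cast
      ring

theorem eLpNorm_two_le {R : ℝ} {f₀ : EuclideanSpace ℝ (Fin d) × EuclideanSpace ℝ (Fin d) → ℝ}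
    (hf : Continuous f₀) (hle : ∀ z, |f₀ z| ≤ speedWeight z.2)
    (hsupp : ∀ z ∉ incomingSet d 2 R, f₀ z = 0) :
    eLpNorm f₀ 2 volume ≤ (4 * volume (ball (0 : EuclideanSpace ℝ (Fin d)) 3) *
      speedIntegral d R) ^ (1 / 2 : ℝ) := by
  rw [eLpNorm_eq_lintegral_rpow_enorm_toReal two_ne_zero ENNReal.ofNat_ne_top, ENNReal.toReal_ofNat]
  refine ENNReal.rpow_le_rpow ?_ (by norm_num)
  rw [Measure.volume_eq_prod, lintegral_prod_symm _ (by fun_prop), speedIntegral,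
    ← lintegral_const_mul _ (by fun_prop), ← lintegral_indicator measurableSet_ball]
  refine lintegral_mono fun v => ?_
  by_cases hv : v ∈ ball (0 : EuclideanSpace ℝ (Fin d)) R
  · rw [indicator_of_mem hv]
    set T := {x : EuclideanSpace ℝ (Fin d) | ∃ t ∈ Icc (0 : ℝ) 1, ‖x + t • v‖ < 2}
    calc ∫⁻ x, ‖f₀ (x, v)‖ₑ ^ (2 : ℝ) ≤ ∫⁻ x, T.indicator
          (fun _ => ENNReal.ofReal (speedWeight v ^ 2)) x := by
          refine lintegral_mono fun x => ?_
          by_cases hx : x ∈ T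
          · rw [indicator_of_mem hx, Real.enorm_eq_ofReal_abs, ENNReal.rpow_ofNat,
              ← ENNReal.ofReal_pow (abs_nonneg _)]
            gcongr
            exact hle (x, v)
          · rw [hsupp (x, v) fun h => hx h.2]
            simp
      _ ≤ ENNReal.ofReal (speedWeight v ^ 2) * volume T := lintegral_indicator_const_le _ _
      _ ≤ ENNReal.ofReal (speedWeight v ^ 2) * (ENNReal.ofReal (‖v‖ + 3) *
          volume (ball (0 : EuclideanSpace ℝ (Fin d)) 3)) := by
          gcongr
          exact volume_incoming_section_le v
      _ = ENNReal.ofReal (speedWeight v ^ 2 * (‖v‖ + 3)) *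
          volume (ball (0 : EuclideanSpace ℝ (Fin d)) 3) := by
          rw [ENNReal.ofReal_mul (sq_nonneg _), mul_assoc]
      _ ≤ ENNReal.ofReal (4 * (1 + ‖v‖ ^ 2) ^ (-(d : ℝ) / 2)) *
          volume (ball (0 : EuclideanSpace ℝ (Fin d)) 3) := by
          exact mul_le_mul_left (ENNReal.ofReal_le_ofReal (speedWeight_sq_mul_le v)) _
      _ = _ := by
          rw [ENNReal.ofReal_mul (by norm_num), ENNReal.ofReal_ofNat]
          ring
  · rw [indicator_of_notMem hv]
    have : ∀ x, f₀ (x, v) = 0 := fun x => hsupp (x, v) fun h => hv (by simpa using h.1)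
    simp [this]

theorem toReal_two_mul_div_add_one (d : ℕ) :
    (2 * (d : ℝ≥0∞) / ((d : ℝ≥0∞) + 1)).toReal = 2 * (d : ℝ) / (d + 1) := by
  rw [ENNReal.toReal_div, ENNReal.toReal_mul, ENNReal.toReal_add (by simp) (by simp)]
  simp

theorem le_mixedNorm (hd : 1 ≤ d) {p : ℝ≥0∞} (hp : p ≠ 0) {R : ℝ}
    {f : ℝ → EuclideanSpace ℝ (Fin d) → EuclideanSpace ℝ (Fin d) → ℝ}
    (hle : ∀ t ∈ Icc (0 : ℝ) 1, ∀ x ∈ ball (0 : EuclideanSpace ℝ (Fin d)) 1,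
      ∀ v ∈ ball (0 : EuclideanSpace ℝ (Fin d)) R, speedWeight v ≤ f t x v) :
    speedIntegral d R ^ (((d : ℝ) + 1) / (2 * d)) *
        volume (ball (0 : EuclideanSpace ℝ (Fin d)) 1) ^ (1 / p.toReal) ≤
      mixedNorm 2 p (2 * (d : ℝ≥0∞) / ((d : ℝ≥0∞) + 1)) f := by
  have hd0 : (0 : ℝ) < d := by exact_mod_cast hd
  set J := speedIntegral d R ^ (((d : ℝ) + 1) / (2 * d)) with hJ
  set B := ball (0 : EuclideanSpace ℝ (Fin d)) 1
  have hr0 : 2 * (d : ℝ≥0∞) / ((d : ℝ≥0∞) + 1) ≠ 0 := by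
    have : d ≠ 0 := by omega
    simp [ENNReal.div_eq_zero_iff, this]
  have hrt : 2 * (d : ℝ≥0∞) / ((d : ℝ≥0∞) + 1) ≠ ⊤ :=
    ENNReal.div_ne_top (ENNReal.mul_ne_top (by simp) (by simp)) (by simp)
  have h1 : ∀ t ∈ Icc (0 : ℝ) 1, ∀ x ∈ B,
      J ≤ eLpNorm (fun v => f t x v) (2 * (d : ℝ≥0∞) / ((d : ℝ≥0∞) + 1)) volume := by
    intro t ht x hx
    rw [eLpNorm_eq_lintegral_rpow_enorm_toReal hr0 hrt, toReal_two_mul_div_add_one, one_div_div, hJ]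
    refine ENNReal.rpow_le_rpow ?_ (by positivity)
    refine le_trans ?_ (setLIntegral_le_lintegral (ball 0 R) _)
    refine setLIntegral_mono' measurableSet_ball fun v hv => ?_
    rw [← speedWeight_rpow, ← ENNReal.ofReal_rpow_of_pos (speedWeight_pos v),
      Real.enorm_eq_ofReal_abs]
    gcongr
    exact (hle t ht x hx v hv).trans (le_abs_self _)
  have h2 : ∀ t ∈ Icc (0 : ℝ) 1, J * volume B ^ (1 / p.toReal) ≤
      eLpNorm (fun x => eLpNorm (fun v => f t x v) (2 * (d : ℝ≥0∞) / ((d : ℝ≥0∞) + 1)) volume)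
        p volume := by
    intro t ht
    -- This includes `p = ⊤` (the case `d = 1`): then `p.toReal = 0`, `1 / 0 = 0`, and the volume
    -- factor is 1.
    rw [show J * volume B ^ (1 / p.toReal) = eLpNorm (B.indicator fun _ => J) p volume by
      rw [eLpNorm_indicator_const' measurableSet_ball (measure_ball_pos _ _ one_pos).ne' hp]
      rfl]
    refine eLpNorm_mono_enorm fun x => ?_
    by_cases hx : x ∈ B
    · rw [indicator_of_mem hx]
      exact h1 t ht x hx
    · rw [indicator_of_notMem hx]
      simp
  set A := J * volume B ^ (1 / p.toReal)
  unfold mixedNorm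
  rw [show A = eLpNorm ((Icc (0 : ℝ) 1).indicator fun _ => A) 2 volume by
    rw [eLpNorm_indicator_const' measurableSet_Icc (by simp) two_ne_zero]
    simp]
  refine eLpNorm_mono_enorm fun t => ?_
  by_cases ht : t ∈ Icc (0 : ℝ) 1
  · rw [indicator_of_mem ht]
    exact h2 t ht
  · rw [indicator_of_notMem ht]
    simp

/-! ### The contradiction -/

theorem speedIntegral_bound_of_estimate (hd : 1 ≤ d) {p : ℝ≥0∞} (hp : p ≠ 0) {C : ℝ≥0}
    (h : ∀ f₀ : EuclideanSpace ℝ (Fin d) × EuclideanSpace ℝ (Fin d) → ℝ,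
      ContDiff ℝ ∞ f₀ → HasCompactSupport f₀ →
      ∀ f : ℝ → EuclideanSpace ℝ (Fin d) → EuclideanSpace ℝ (Fin d) → ℝ,
        IsKineticTransportSolution f f₀ →
        mixedNorm 2 p (2 * (d : ℝ≥0∞) / ((d : ℝ≥0∞) + 1)) f ≤ (C : ℝ≥0∞) * eLpNorm f₀ 2 volume)
    (R : ℝ) :
    speedIntegral d R ^ (((d : ℝ) + 1) / (2 * d)) *
        volume (ball (0 : EuclideanSpace ℝ (Fin d)) 1) ^ (1 / p.toReal) ≤
      C * (4 * volume (ball (0 : EuclideanSpace ℝ (Fin d)) 3) *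
        (2 ^ d * speedIntegral d R)) ^ (1 / 2 : ℝ) := by
  obtain ⟨χ, hχ, hχI, hχ0, hχ1⟩ := exists_cutoff (d := d) R
  set f₀ : EuclideanSpace ℝ (Fin d) × EuclideanSpace ℝ (Fin d) → ℝ :=
    fun z => χ z * speedWeight z.2 with hf₀
  have hsmooth : ContDiff ℝ ∞ f₀ := hχ.mul (contDiff_speedWeight.comp contDiff_snd)
  have hsupp : ∀ z ∉ incomingSet d 2 (2 * R), f₀ z = 0 := fun z hz => by simp [hf₀, hχ0 z hz]
  have hcs : HasCompactSupport f₀ :=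
    HasCompactSupport.intro (isCompact_closedBall 0 (|2| + |2 * R|)) fun z hz =>
      hsupp z fun hz' => hz (incomingSet_subset_closedBall _ _ hz')
  have hle : ∀ z, |f₀ z| ≤ speedWeight z.2 := fun z => by
    rw [hf₀, abs_of_nonneg (mul_nonneg (hχI z).1 (speedWeight_pos _).le)]
    exact mul_le_of_le_one_left (speedWeight_pos _).le (hχI z).2
  calc _ ≤ mixedNorm 2 p (2 * (d : ℝ≥0∞) / ((d : ℝ≥0∞) + 1)) (freeTransport f₀) := by
        refine le_mixedNorm hd hp fun t ht x hx v hv => ?_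
        have : (x - t • v, v) ∈ incomingSet d 1 R :=
          ⟨by simpa using hv, t, ht, by simpa using hx⟩
        simp [freeTransport, hf₀, hχ1 _ this]
    _ ≤ C * eLpNorm f₀ 2 volume :=
        h f₀ hsmooth hcs _ (isKineticTransportSolution_freeTransport (hsmooth.of_le (by simp)))
    _ ≤ C * (4 * volume (ball (0 : EuclideanSpace ℝ (Fin d)) 3) *
        speedIntegral d (2 * R)) ^ (1 / 2 : ℝ) := by
        gcongr
        exact eLpNorm_two_le hsmooth.continuous hle hsupp
    _ ≤ _ := by
        gcongr
        exact speedIntegral_two_mul_le R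

theorem theorem1p1 (d : ℕ) (hd : 1 ≤ d) : ¬ EndpointStrichartzEstimate d := by
  rintro ⟨C, h⟩
  have hd0 : (0 : ℝ) < d := by exact_mod_cast hd
  have hp : 2 * (d : ℝ≥0∞) / ((d : ℝ≥0∞) - 1) ≠ 0 := by
    have : d ≠ 0 := by omega
    simp [ENNReal.div_eq_zero_iff, this]
  have key := speedIntegral_bound_of_estimate hd hp h
  set A := volume (ball (0 : EuclideanSpace ℝ (Fin d)) 1) ^
    (1 / (2 * (d : ℝ≥0∞) / ((d : ℝ≥0∞) - 1)).toReal)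
  have hA0 : A ≠ 0 := by
    have := (measure_ball_pos volume (0 : EuclideanSpace ℝ (Fin d)) one_pos)
    exact (ENNReal.rpow_pos this measure_ball_lt_top.ne).ne'
  have hAt : A ≠ ⊤ := ENNReal.rpow_ne_top_of_nonneg (by positivity) measure_ball_lt_top.ne
  set D := 4 * volume (ball (0 : EuclideanSpace ℝ (Fin d)) 3) * 2 ^ d
  have hDt : D ≠ ⊤ := ENNReal.mul_ne_top
    (ENNReal.mul_ne_top (by simp) measure_ball_lt_top.ne) (by simp)
  set M := (C * D ^ (1 / 2 : ℝ) / A) ^ (2 * (d : ℝ))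
  have hM : M ≠ ⊤ := by
    refine ENNReal.rpow_ne_top_of_nonneg (by positivity) (ENNReal.div_ne_top ?_ hA0)
    exact ENNReal.mul_ne_top (by simp) (ENNReal.rpow_ne_top_of_nonneg (by norm_num) hDt)
  have hbound : ∀ n : ℕ, speedIntegral d (n + 1) ≤ M := by
    intro n
    have hJ0 : speedIntegral d (n + 1) ≠ 0 := (speedIntegral_pos (by positivity)).ne'
    have hJt := (speedIntegral_lt_top (d := d) (n + 1)).ne
    have h1 := key (n + 1)
    set J := speedIntegral d (n + 1)
    -- After cancelling `J ^ (1/2)`, the surplus `J ^ (1/(2d))` is bounded independently of `n`;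
    -- raising to the power `2d` gives `M`.
    have e : ((d : ℝ) + 1) / (2 * d) = 1 / 2 + 1 / (2 * d) := by field_simp
    rw [← mul_assoc, ENNReal.mul_rpow_of_nonneg _ _ (by norm_num : (0 : ℝ) ≤ 1 / 2), e,
      ENNReal.rpow_add _ _ hJ0 hJt, ← mul_assoc, mul_assoc, mul_comm, mul_comm _ A] at h1
    have hs0 : J ^ (1 / 2 : ℝ) ≠ 0 := (ENNReal.rpow_pos hJ0.bot_lt hJt).ne'
    have hst : J ^ (1 / 2 : ℝ) ≠ ⊤ := ENNReal.rpow_ne_top_of_nonneg (by norm_num) hJt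
    rw [ENNReal.mul_le_mul_iff_left hs0 hst, mul_comm, ← ENNReal.le_div_iff_mul_le (.inl hA0)
      (.inl hAt)] at h1
    calc J = (J ^ (1 / (2 * d) : ℝ)) ^ (2 * (d : ℝ)) := by
          rw [← ENNReal.rpow_mul, one_div_mul_cancel (by positivity), ENNReal.rpow_one]
      _ ≤ M := ENNReal.rpow_le_rpow h1 (by positivity)
  exact hM (top_le_iff.1 (iSup_speedIntegral hd ▸ iSup_le hbound))
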